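/- Let $n\ge 1$. For a smooth Hamiltonian $H=H(q,p,t)\in C^\infty(\mathbb R^{n}\times\mathbb R^{n}\times\mathbb R)$ consider the coupled pair of first-order partial differential equations $$\frac{\partial S}{\partial t_0}=-H\bigl(q_0,\nabla_{q_0}S,t_0\bigr),\qquad \frac{\partial S}{\partial t}=H\bigl(q,\nabla_qS,t\bigr)\qquad(1)$$ for a function $S=S(q,t;q_0,t_0)$ on $\mathbb R^{2n+2}$, or, in the other usual sign convention (with $p=\nabla_q S$, $p_0=-\nabla_{q_0}S$), the pair $$\frac{\partial S}{\partial t_0}=H\bigl(q_0,-\nabla_{q_0}S,t_0\bigr),\qquad \frac{\partial S}{\partial t}=-H\bigl(q,\nabla_qS,t\bigr).\qquad(2)$$ Call $H$ globally solvable if the pair has a solution $S\in C^2(\mathbb R^{2n+2})$ that satisfies both equations at all $(q,t;q_0,t_0)$. A finite description of $H$ is a pair of programs: the first computes every partial derivative of $H$ (of every order, including order $0$) at every rational point to within $2^{-k}$, for every given $k$; the second computes a modulus of uniform continuity for every such derivative on every cube $[-N,N]^{2n+1}$. Then, for each of the two sign conventions: (a) There is no algorithm that, given any finite description of any smooth Hamiltonian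 $H$ of $n$ degrees of freedom, halts and correctly answers whether $H$ is globally solvable. (b) The halting problem is many-one reducible to this question: there is a computable map that sends every program $M$ and input $x$ to a finite description of a smooth Hamiltonian $H_{M,x}$ such that $M$ halts on $x$ if and only if $H_{M,x}$ is globally solvable; moreover, if $M$ halts on $x$, then the pair of equations for $H_{M,x}$ even has a solution $S\in C^\infty(\mathbb R^{2n+2})$. -/

import Mathlib

open scoped ContDiff

namespace HPF

/-- The points `(q, p, t)` of extended phase space, `ℝⁿ × ℝⁿ × ℝ`. -/
abbrev PhasePt (n : ℕ) : Type := (Fin n → ℝ) × (Fin n → ℝ) × ℝ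

/-- The points `(q, t; q₀, t₀)` of `ℝ^(2n+2)`. -/
abbrev EndPts (n : ℕ) : Type := (Fin n → ℝ) × ℝ × (Fin n → ℝ) × ℝ

section PDE

variable {n : ℕ}

/-- `∇_q S` at `X = (q, t; q₀, t₀)`. -/
noncomputable def gradQ (S : EndPts n → ℝ) (X : EndPts n) : Fin n → ℝ :=
  fun i => fderiv ℝ S X (Pi.single i 1, 0, 0, 0)

/-- `∂S/∂t` at `X = (q, t; q₀, t₀)`. -/
noncomputable def derivT (S : EndPts n → ℝ) (X : EndPts n) : ℝ :=
  fderiv ℝ S X (0, 1, 0, 0)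

/-- `∇_{q₀} S` at `X = (q, t; q₀, t₀)`. -/
noncomputable def gradQ₀ (S : EndPts n → ℝ) (X : EndPts n) : Fin n → ℝ :=
  fun i => fderiv ℝ S X (0, 0, Pi.single i 1, 0)

/-- `∂S/∂t₀` at `X = (q, t; q₀, t₀)`. -/
noncomputable def derivT₀ (S : EndPts n → ℝ) (X : EndPts n) : ℝ :=
  fderiv ℝ S X (0, 0, 0, 1)

/-- The two sign conventions in use for the pair of equations of Hamilton's principal function. -/
inductive SignConvention : Type
  /-- `∂S/∂t₀ = -H(q₀, ∇_{q₀}S, t₀)` and `∂S/∂t = H(q, ∇_q S, t)`. -/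
  | plus
  /-- `∂S/∂t₀ = H(q₀, -∇_{q₀}S, t₀)` and `∂S/∂t = -H(q, ∇_q S, t)`, that is, the equations
  `∂S/∂t₀ = H₀`, `∂S/∂t = -H` with `p = ∇_q S` and `p₀ = -∇_{q₀} S`. -/
  | minus

/-- `S` satisfies the coupled pair of first-order equations of Hamilton's principal function for
the Hamiltonian `H`, at all `(q, t; q₀, t₀)`. -/
def SolvesPair (H : PhasePt n → ℝ) (S : EndPts n → ℝ) : SignConvention → Prop
  | .plus => ∀ (q : Fin n → ℝ) (t : ℝ) (q₀ : Fin n → ℝ) (t₀ : ℝ),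
      derivT₀ S (q, t, q₀, t₀) = -H (q₀, gradQ₀ S (q, t, q₀, t₀), t₀) ∧
      derivT S (q, t, q₀, t₀) = H (q, gradQ S (q, t, q₀, t₀), t)
  | .minus => ∀ (q : Fin n → ℝ) (t : ℝ) (q₀ : Fin n → ℝ) (t₀ : ℝ),
      derivT₀ S (q, t, q₀, t₀) = H (q₀, -gradQ₀ S (q, t, q₀, t₀), t₀) ∧
      derivT S (q, t, q₀, t₀) = -H (q, gradQ S (q, t, q₀, t₀), t)

/-- The pair of equations has a global solution of class `C²` on all of `ℝ^(2n+2)`. -/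
def GloballySolvable (σ : SignConvention) (H : PhasePt n → ℝ) : Prop :=
  ∃ S : EndPts n → ℝ, ContDiff ℝ 2 S ∧ SolvesPair H S σ

end PDE

section Descriptions

/-- `(a, b, d)` is a notation for the rational number `(a - b) / (d + 1)`. -/
abbrev RatCode : Type := ℕ × ℕ × ℕ

/-- The rational number denoted by `(a, b, d)`, as a real number. -/
noncomputable def RatCode.val (r : RatCode) : ℝ := ((r.1 : ℝ) - r.2.1) / (r.2.2 + 1)

/-- Notations for the rational points of extended phase space. -/
abbrev RatPt (n : ℕ) : Type := (Fin n → RatCode) × (Fin n → RatCode) × RatCode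

/-- The point of extended phase space denoted by `x`. -/
noncomputable def RatPt.val {n : ℕ} (x : RatPt n) : PhasePt n :=
  (fun i => (x.1 i).val, fun i => (x.2.1 i).val, x.2.2.val)

/-- The names of the `2n + 1` coordinates `qᵢ`, `pᵢ`, `t`. -/
abbrev Coord (n : ℕ) : Type := Fin n ⊕ Fin n ⊕ Unit

/-- The unit vector of a coordinate. -/
def Coord.dir {n : ℕ} : Coord n → PhasePt n
  | .inl i => (Pi.single i 1, 0, 0)
  | .inr (.inl i) => (0, Pi.single i 1, 0)
  | .inr (.inr _) => (0, 0, 1)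

/-- The iterated partial derivative of `H` along the coordinates listed in `l`; `H` itself for
the empty list. -/
noncomputable def iterPartial {n : ℕ} (H : PhasePt n → ℝ) : List (Coord n) → PhasePt n → ℝ
  | [] => H
  | i :: l => fun x => fderiv ℝ (iterPartial H l) x i.dir

/-- The numerical code of a finite object, in Mathlib's standard computable coding. -/
def enc {α : Type} [Primcodable α] (a : α) : ℕ := Encodable.encode a

/-- A finite description of a Hamiltonian: two programs. -/
abbrev Description : Type := Nat.Partrec.Code × Nat.Partrec.Code

/-- The description `d` describes the smooth function `H`, in the sense of computable analysis.
The first program, given a list of coordinates, a rational point and `k`, returns a rational number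
within `2⁻ᵏ` of that partial derivative of `H` at that point. The second one, given a list of
coordinates, `N` and `k`, returns an `m` such that this partial derivative varies by at most `2⁻ᵏ`
over distances of at most `2⁻ᵐ` within the cube `[-N, N]^(2n+1)` (the norm is the maximum norm). -/
structure Describes {n : ℕ} (d : Description) (H : PhasePt n → ℝ) : Prop where
  smooth : ContDiff ℝ ∞ H
  approx : ∀ (l : List (Coord n)) (x : RatPt n) (k : ℕ),
    ∃ r : RatCode, enc r ∈ d.1.eval (enc (l, x, k)) ∧
      |r.val - iterPartial H l x.val| ≤ 2⁻¹ ^ k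
  modulus : ∀ (l : List (Coord n)) (N k : ℕ),
    ∃ m : ℕ, m ∈ d.2.eval (enc (l, N, k)) ∧
      ∀ x y : PhasePt n, ‖x‖ ≤ N → ‖y‖ ≤ N → ‖x - y‖ ≤ 2⁻¹ ^ m →
        |iterPartial H l x - iterPartial H l y| ≤ 2⁻¹ ^ k

end Descriptions

/-- The algorithm `D` decides global `C²` solvability for Hamiltonians of `n` degrees of freedom:
on every description of every smooth Hamiltonian it halts with the right answer. Nothing is asked
of `D` on pairs of programs that describe no smooth Hamiltonian. -/
def DecidesSolvability (n : ℕ) (σ : SignConvention) (D : Description →. Bool) : Prop :=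
  ∀ (d : Description) (H : PhasePt n → ℝ), Describes d H →
    ∃ b ∈ D d, (b = true ↔ GloballySolvable σ H)

end HPF

/-!
To `M` and `x` one assigns the real number `c ≥ 0` whose `k`-th binary digit says whether `M` has
halted on `x` at stage `k`. It can be computed uniformly in `M` and `x`, although `c > 0` means that
`M` halts on `x`. The Hamiltonian is `p² + q² - c q⁴` in one conjugate pair of variables.

For `c > 0` the potential `V = q² - c q⁴` is bounded above, `V < E`, and
`E (t - t₀) + W(q) - W(q₀)` with `W' = √(E - V)` is a smooth global solution. For `c = 0` the
inequality `p² + p u ≥ -u² / 4` bounds the increase of a solution along any path from below by the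
action `∫ (V - u² / 4)`. With enough time for the trip, going out to `q`, resting there and coming
back makes this action arbitrarily large as `q → ∞`, while the end points stay the same.

Partial derivatives of powers of one coordinate are explicit, and a bound for a derivative of the
next order is a Lipschitz constant, so such powers have computable descriptions; sums and computable
multiples inherit them.
-/

namespace HPF

open Nat.Partrec (Code)

section HamiltonJacobi

variable {n : ℕ}

lemma solvesPair_minus_iff_neg {H : PhasePt n → ℝ} (hH : ∀ q p t, H (q, -p, t) = H (q, p, t))
    (S : EndPts n → ℝ) : SolvesPair H S .minus ↔ SolvesPair H (-S) .plus := by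
  have hgradQ (X : EndPts n) : gradQ (-S) X = -gradQ S X := by ext; simp [gradQ, fderiv_neg]
  have hgradQ₀ (X : EndPts n) : gradQ₀ (-S) X = -gradQ₀ S X := by ext; simp [gradQ₀, fderiv_neg]
  have hderivT (X : EndPts n) : derivT (-S) X = -derivT S X := by simp [derivT, fderiv_neg]
  have hderivT₀ (X : EndPts n) : derivT₀ (-S) X = -derivT₀ S X := by simp [derivT₀, fderiv_neg]
  simp only [SolvesPair, hgradQ, hgradQ₀, hderivT, hderivT₀, hH, neg_eq_iff_eq_neg, neg_neg]

lemma exists_contDiff_solvesPair_iff_plus {H : PhasePt n → ℝ}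
    (hH : ∀ q p t, H (q, -p, t) = H (q, p, t)) {k : WithTop ℕ∞} (σ : SignConvention) :
    (∃ S, ContDiff ℝ k S ∧ SolvesPair H S σ) ↔ ∃ S, ContDiff ℝ k S ∧ SolvesPair H S .plus := by
  cases σ with
  | plus => rfl
  | minus =>
    constructor <;> rintro ⟨S, hS, hpair⟩
    · exact ⟨-S, hS.neg, (solvesPair_minus_iff_neg hH S).1 hpair⟩
    · exact ⟨-S, hS.neg, (solvesPair_minus_iff_neg hH (-S)).2 (by rwa [neg_neg])⟩

/-- The Hamiltonian `pⱼ² + V(qⱼ)` of a particle that moves along the `j`-th axis in the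
potential `V`. -/
def particle (V : ℝ → ℝ) (j : Fin n) (x : PhasePt n) : ℝ := x.2.1 j ^ 2 + V (x.1 j)

lemma particle_neg_momentum (V : ℝ → ℝ) (j : Fin n) (q p : Fin n → ℝ) (t : ℝ) :
    particle V j (q, -p, t) = particle V j (q, p, t) := by
  simp [particle]

variable {V : ℝ → ℝ} {j : Fin n} {S : EndPts n → ℝ}

/-- Along a straight path with velocity `v / τ` the action increases at least as fast as the
Lagrangian `V - (v / τ)² / 4` prescribes, because `p² + p u ≥ -u² / 4`. -/
lemma SolvesPair.le_sub_of_le_potential (h : SolvesPair (particle V j) S .plus)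
    (hS : Differentiable ℝ S) (q : Fin n → ℝ) (t : ℝ) (q₀ : Fin n → ℝ) (t₀ : ℝ) {τ v m : ℝ}
    (hτ : 0 < τ) (hm : ∀ y ∈ segment ℝ (q j) (q j + v), m ≤ V y) :
    τ * m - v ^ 2 / (4 * τ) ≤
      S (q + Pi.single j v, t + τ, q₀, t₀) - S (q, t, q₀, t₀) := by
  obtain ⟨_, hz, hslope⟩ := domain_mvt (x := (q, t, q₀, t₀))
    (y := (q + Pi.single j v, t + τ, q₀, t₀))
    (fun X _ => (hS X).hasFDerivAt.hasFDerivWithinAt) convex_univ trivial trivial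
  rw [segment_eq_image'] at hz
  obtain ⟨s, hs, rfl⟩ := hz
  set X : EndPts n := (q, t, q₀, t₀) + s • ((q + Pi.single j v, t + τ, q₀, t₀) - (q, t, q₀, t₀))
  have hdir : ((q + Pi.single j v, t + τ, q₀, t₀) - (q, t, q₀, t₀) : EndPts n) =
      v • (Pi.single j 1, 0, 0, 0) + τ • (0, 1, 0, 0) := by
    ext <;> simp [← Pi.single_smul]
  have hincr : fderiv ℝ S X ((q + Pi.single j v, t + τ, q₀, t₀) - (q, t, q₀, t₀)) =
      v * gradQ S X j + τ * (gradQ S X j ^ 2 + V (X.1 j)) := by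
    rw [hdir, map_add, map_smul, map_smul]
    exact congrArg (fun y => _ + τ * y) (h X.1 X.2.1 X.2.2.1 X.2.2.2).2
  have hmX : m ≤ V (X.1 j) := by
    refine hm _ ?_
    rw [segment_eq_image']
    exact ⟨s, hs, by simp [X]⟩
  rw [hslope, hincr, ← sub_nonneg]
  have hsquare : v * gradQ S X j + τ * (gradQ S X j ^ 2 + V (X.1 j)) - (τ * m - v ^ 2 / (4 * τ)) =
      τ * (V (X.1 j) - m) + τ * (gradQ S X j + v / (2 * τ)) ^ 2 := by
    field_simp
    ring
  rw [hsquare]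
  exact add_nonneg (mul_nonneg hτ.le (sub_nonneg.2 hmX)) (by positivity)

/-- On a trip from `0` to a distant point `c`, a rest there and a trip back, each of
duration `1 + 1 / a`, the action would increase by at least `c² / 2`. -/
theorem not_solvesPair_particle_of_quadratic_le {a : ℝ} (ha : 0 < a) (hV : ∀ x, a * x ^ 2 ≤ V x)
    (hS : Differentiable ℝ S) : ¬ SolvesPair (particle V j) S .plus := by
  intro h
  have hV₀ (x : ℝ) : 0 ≤ V x := le_trans (by positivity) (hV x)
  set τ := 1 + a⁻¹
  have hτ : 0 < τ := by positivity
  have hgain (c : ℝ) : c ^ 2 / 2 ≤ S (0, τ + τ + τ, 0, 0) - S (0, 0, 0, 0) := by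
    have hout := h.le_sub_of_le_potential hS 0 0 0 0 (v := c) hτ fun y _ => hV₀ y
    have hrest := h.le_sub_of_le_potential hS (Pi.single j c) τ 0 0 (v := 0) (m := a * c ^ 2) hτ
      (by simpa using hV c)
    have hback := h.le_sub_of_le_potential hS (Pi.single j c) (τ + τ) 0 0 (v := -c) hτ
      fun y _ => hV₀ y
    simp only [zero_add, add_zero, Pi.single_zero, ← Pi.single_add, add_neg_cancel, mul_zero,
      zero_sub, neg_sq, ne_eq, OfNat.ofNat_ne_zero, not_false_eq_true, zero_pow, zero_div,
      sub_zero] at hout hrest hback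
    have hcost : c ^ 2 / (4 * τ) ≤ c ^ 2 / 4 :=
      div_le_div_of_nonneg_left (sq_nonneg c) (by norm_num) (by simp [τ, ha.le])
    have hτa : τ * (a * c ^ 2) = (a + 1) * c ^ 2 := by simp only [τ]; field_simp
    nlinarith [mul_nonneg ha.le (sq_nonneg c)]
  set D := S (0, τ + τ + τ, 0, 0) - S (0, 0, 0, 0)
  nlinarith [hgain (|D| + 2), le_abs_self D, abs_nonneg D]

lemma solvesPair_particle_of_hasDerivAt {W w : ℝ → ℝ} {E : ℝ} (hW : ∀ x, HasDerivAt W (w x) x)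
    (hE : ∀ x, w x ^ 2 + V x = E) (j : Fin n) :
    SolvesPair (particle V j)
      (fun X => E * (X.2.1 - X.2.2.2) + (W (X.1 j) - W (X.2.2.1 j))) .plus := by
  intro q t q₀ t₀
  set S : EndPts n → ℝ := fun X => E * (X.2.1 - X.2.2.2) + (W (X.1 j) - W (X.2.2.1 j))
  let X : EndPts n := (q, t, q₀, t₀)
  have hq := (ContinuousLinearMap.proj (R := ℝ) (φ := fun _ : Fin n => ℝ) j ∘SL
    .fst ℝ _ (ℝ × (Fin n → ℝ) × ℝ)).hasFDerivAt (x := X)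
  have hq₀ := (ContinuousLinearMap.proj (R := ℝ) (φ := fun _ : Fin n => ℝ) j ∘SL
    .fst ℝ _ ℝ ∘SL .snd ℝ ℝ _ ∘SL .snd ℝ (Fin n → ℝ) _).hasFDerivAt (x := X)
  have hS : HasFDerivAt S _ X :=
    ((hasFDerivAt_snd.fst.sub hasFDerivAt_snd.snd.snd).const_mul E).add
      (((hW (q j)).comp_hasFDerivAt X hq).sub ((hW (q₀ j)).comp_hasFDerivAt X hq₀))
  simp [derivT, derivT₀, gradQ, gradQ₀, particle, hS.fderiv, X, hE]

/-- If `V ≤ B`, then a particle of energy `B + 1` never turns around, and the time-independent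
solution `W = ∫ √(B + 1 - V)` is globally defined and smooth. -/
theorem exists_contDiff_solvesPair_particle (hV : ContDiff ℝ ∞ V) {B : ℝ} (hB : ∀ x, V x ≤ B)
    (j : Fin n) : ∃ S : EndPts n → ℝ, ContDiff ℝ ∞ S ∧ SolvesPair (particle V j) S .plus := by
  have hpos (x : ℝ) : 0 < B + 1 - V x := by linarith [hB x]
  have hw : ContDiff ℝ ∞ fun x => √(B + 1 - V x) :=
    (contDiff_const.sub hV).sqrt fun x => (hpos x).ne'
  have hW (x : ℝ) : HasDerivAt (fun y => ∫ s in (0 : ℝ)..y, √(B + 1 - V s)) (√(B + 1 - V x)) x :=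
    (hw.continuous.integral_hasStrictDerivAt 0 x).hasDerivAt
  have hWsmooth : ContDiff ℝ ∞ fun y => ∫ s in (0 : ℝ)..y, √(B + 1 - V s) := by
    refine contDiff_infty_iff_deriv.2 ⟨fun x => (hW x).differentiableAt, ?_⟩
    rwa [funext fun x => (hW x).deriv]
  have hE (x : ℝ) : √(B + 1 - V x) ^ 2 + V x = B + 1 := by
    rw [Real.sq_sqrt (hpos x).le, sub_add_cancel]
  refine ⟨_, ContDiff.add (by fun_prop) (.sub ?_ ?_), solvesPair_particle_of_hasDerivAt hW hE j⟩
  · exact hWsmooth.comp (by fun_prop : ContDiff ℝ ∞ fun X : EndPts n => X.1 j)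
  · exact hWsmooth.comp (by fun_prop : ContDiff ℝ ∞ fun X : EndPts n => X.2.2.1 j)

/-- The potential `x² - c x⁴`, which for `c ≥ 0` is bounded above exactly when `c ≠ 0`. -/
def quarticPotential (c x : ℝ) : ℝ := x ^ 2 - c * x ^ 4

lemma quarticPotential_le {c : ℝ} (hc : 0 < c) (x : ℝ) : quarticPotential c x ≤ (4 * c)⁻¹ := by
  rw [quarticPotential, ← one_div, le_div_iff₀ (by positivity)]
  nlinarith [sq_nonneg (1 - 2 * c * x ^ 2)]

theorem exists_contDiff_solvesPair_quartic {c : ℝ} (hc : 0 < c) (j : Fin n) (σ : SignConvention) :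
    ∃ S, ContDiff ℝ ∞ S ∧ SolvesPair (particle (quarticPotential c) j) S σ := by
  have hV : ContDiff ℝ ∞ (quarticPotential c) := by unfold quarticPotential; fun_prop
  exact (exists_contDiff_solvesPair_iff_plus (particle_neg_momentum _ j) σ).2
    (exists_contDiff_solvesPair_particle hV (quarticPotential_le hc) j)

theorem globallySolvable_quartic_iff {c : ℝ} (hc : 0 ≤ c) (j : Fin n) (σ : SignConvention) :
    GloballySolvable σ (particle (quarticPotential c) j) ↔ 0 < c := by
  refine ⟨fun h => hc.lt_of_ne ?_, fun h => ?_⟩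
  · rintro rfl
    obtain ⟨S, hS, hpair⟩ := (exists_contDiff_solvesPair_iff_plus (particle_neg_momentum _ j) σ).1 h
    exact not_solvesPair_particle_of_quadratic_le one_pos (by simp [quarticPotential])
      (hS.differentiable two_ne_zero) hpair
  · obtain ⟨S, hS, hpair⟩ := exists_contDiff_solvesPair_quartic h j σ
    exact ⟨S, by exact_mod_cast contDiff_infty.1 hS 2, hpair⟩

end HamiltonJacobi

namespace RatCode

/-- A notation for the sum; the denominator is `(r.2.2 + 1) * (s.2.2 + 1)`. -/
def add (r s : RatCode) : RatCode :=
  (r.1 * (s.2.2 + 1) + s.1 * (r.2.2 + 1), r.2.1 * (s.2.2 + 1) + s.2.1 * (r.2.2 + 1),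
    r.2.2 * s.2.2 + r.2.2 + s.2.2)

/-- A notation for the product; the denominator is `(r.2.2 + 1) * (s.2.2 + 1)`. -/
def mul (r s : RatCode) : RatCode :=
  (r.1 * s.1 + r.2.1 * s.2.1, r.1 * s.2.1 + r.2.1 * s.1, r.2.2 * s.2.2 + r.2.2 + s.2.2)

/-- A notation for the `k`-th power. -/
def pow (r : RatCode) (k : ℕ) : RatCode := k.rec (1, 0, 0) fun _ s => r.mul s

/-- A notation for the sum of the first `k` terms of `f`. -/
def sum (f : ℕ → RatCode) (k : ℕ) : RatCode := k.rec (0, 0, 0) fun i s => s.add (f i)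

lemma val_add (r s : RatCode) : (r.add s).val = r.val + s.val := by
  simp only [val, add]
  push_cast
  rw [div_add_div _ _ (by positivity) (by positivity)]
  congr 1 <;> ring

lemma val_mul (r s : RatCode) : (r.mul s).val = r.val * s.val := by
  simp only [val, mul]
  push_cast
  rw [div_mul_div_comm]
  congr 1 <;> ring

lemma val_natCast (m : ℕ) : val (m, 0, 0) = m := by simp [val]

lemma val_pow (r : RatCode) (k : ℕ) : (r.pow k).val = r.val ^ k := by
  induction k with
  | zero => simp [pow, val]
  | succ k ih => rw [pow_succ', ← ih]; exact val_mul r (r.pow k)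

lemma val_sum (f : ℕ → RatCode) (k : ℕ) : (sum f k).val = ∑ i ∈ Finset.range k, (f i).val := by
  induction k with
  | zero => simp [sum, val]
  | succ k ih => rw [Finset.sum_range_succ, ← ih]; exact val_add (sum f k) (f k)

lemma abs_val_le (r : RatCode) : |r.val| ≤ (r.1 + r.2.1 : ℕ) := by
  rw [val, abs_div, abs_of_pos (by positivity : (0 : ℝ) < r.2.2 + 1)]
  refine (div_le_self (abs_nonneg _) (by simp)).trans ((abs_sub _ _).trans ?_)
  simp

open Primrec in
lemma primrec_add : Primrec₂ add := by
  have a : Primrec fun p : RatCode × RatCode => p.1.1 := fst.comp fst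
  have b : Primrec fun p : RatCode × RatCode => p.1.2.1 := fst.comp (snd.comp fst)
  have d : Primrec fun p : RatCode × RatCode => p.1.2.2 := snd.comp (snd.comp fst)
  have a' : Primrec fun p : RatCode × RatCode => p.2.1 := fst.comp snd
  have b' : Primrec fun p : RatCode × RatCode => p.2.2.1 := fst.comp (snd.comp snd)
  have d' : Primrec fun p : RatCode × RatCode => p.2.2.2 := snd.comp (snd.comp snd)
  exact (nat_add.comp (nat_mul.comp a (succ.comp d')) (nat_mul.comp a' (succ.comp d))).pair
    ((nat_add.comp (nat_mul.comp b (succ.comp d')) (nat_mul.comp b' (succ.comp d))).pair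
      (nat_add.comp (nat_add.comp (nat_mul.comp d d') d) d'))

open Primrec in
lemma primrec_mul : Primrec₂ mul := by
  have a : Primrec fun p : RatCode × RatCode => p.1.1 := fst.comp fst
  have b : Primrec fun p : RatCode × RatCode => p.1.2.1 := fst.comp (snd.comp fst)
  have d : Primrec fun p : RatCode × RatCode => p.1.2.2 := snd.comp (snd.comp fst)
  have a' : Primrec fun p : RatCode × RatCode => p.2.1 := fst.comp snd
  have b' : Primrec fun p : RatCode × RatCode => p.2.2.1 := fst.comp (snd.comp snd)
  have d' : Primrec fun p : RatCode × RatCode => p.2.2.2 := snd.comp (snd.comp snd)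
  exact (nat_add.comp (nat_mul.comp a a') (nat_mul.comp b b')).pair
    ((nat_add.comp (nat_mul.comp a b') (nat_mul.comp b a')).pair
      (nat_add.comp (nat_add.comp (nat_mul.comp d d') d) d'))

lemma primrec_pow : Primrec₂ pow :=
  Primrec.nat_rec (.const _) (primrec_mul.comp .fst (Primrec.snd.comp .snd)).to₂

lemma computable_sum {α : Type} [Primcodable α] {f : α → ℕ → RatCode} (hf : Computable₂ f) :
    Computable fun p : α × ℕ => sum (f p.1) p.2 :=
  .nat_rec (h := fun (p : α × ℕ) (q : ℕ × RatCode) => q.2.add (f p.1 q.1)) .snd (.const _) <|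
    (primrec_add.to_comp.comp (Computable.snd.comp .snd)
      (hf.comp (Computable.fst.comp .fst) (Computable.fst.comp .snd))).to₂

end RatCode

section ComputableReals

variable {α β : Type} [Primcodable α] [Primcodable β] {c d : α → ℝ}

/-- The reals `c a` are computable uniformly in `a`: one program approximates all of them, with
the precision `2⁻ᵏ` as an additional input. -/
def UniformlyComputable (c : α → ℝ) : Prop :=
  ∃ f : α × ℕ → RatCode, Computable f ∧ ∀ a k, |(f (a, k)).val - c a| ≤ 2⁻¹ ^ k

lemma abs_add_le_two_inv_pow {x y : ℝ} {k : ℕ} (hx : |x| ≤ 2⁻¹ ^ (k + 1))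
    (hy : |y| ≤ 2⁻¹ ^ (k + 1)) : |x + y| ≤ 2⁻¹ ^ k :=
  (abs_add_le x y).trans <| (add_le_add hx hy).trans_eq (by ring)

lemma abs_mul_le_two_inv_pow {x y : ℝ} {k m : ℕ} (hx : |x| ≤ m) (hy : |y| ≤ 2⁻¹ ^ (k + m)) :
    |x * y| ≤ 2⁻¹ ^ k := by
  have hm : (m : ℝ) ≤ 2 ^ m := by exact_mod_cast m.lt_two_pow_self.le
  calc |x * y| = |x| * |y| := abs_mul x y
    _ ≤ 2 ^ m * 2⁻¹ ^ (k + m) := by gcongr; exact hx.trans hm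
    _ = 2⁻¹ ^ k := by rw [pow_add, mul_left_comm, ← mul_pow, mul_inv_cancel₀ two_ne_zero]; simp

namespace UniformlyComputable

lemma of_val {r : α → RatCode} (hr : Computable r) : UniformlyComputable fun a => (r a).val :=
  ⟨fun p => r p.1, hr.comp .fst, fun a k => by simp⟩

lemma of_natCast {m : α → ℕ} (hm : Computable m) : UniformlyComputable fun a => (m a : ℝ) := by
  simpa only [RatCode.val_natCast] using of_val (hm.pair (.const (0, 0)))

lemma comp (hc : UniformlyComputable c) {g : β → α} (hg : Computable g) :
    UniformlyComputable fun b => c (g b) :=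
  let ⟨f, hf, hfc⟩ := hc
  ⟨fun p => f (g p.1, p.2), hf.comp ((hg.comp .fst).pair .snd), fun b => hfc (g b)⟩

lemma exists_natCast_bound (hc : UniformlyComputable c) :
    ∃ B : α → ℕ, Computable B ∧ ∀ a, |c a| ≤ B a := by
  obtain ⟨f, hf, hfc⟩ := hc
  have hf₀ : Computable fun a => f (a, 0) := hf.comp (Computable.id.pair (.const 0))
  refine ⟨fun a => (f (a, 0)).1 + (f (a, 0)).2.1 + 1, ?_, fun a => ?_⟩
  · exact Computable.succ.comp (Primrec.nat_add.to_comp.comp (Computable.fst.comp hf₀)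
      (Computable.fst.comp (Computable.snd.comp hf₀)))
  · have hval := (f (a, 0)).abs_val_le
    have happrox := hfc a 0
    rw [pow_zero, abs_sub_comm] at happrox
    rw [Nat.cast_add_one]
    linarith [abs_sub_abs_le_abs_sub (c a) (f (a, 0)).val]

protected lemma add (hc : UniformlyComputable c) (hd : UniformlyComputable d) :
    UniformlyComputable fun a => c a + d a := by
  obtain ⟨f, hf, hfc⟩ := hc
  obtain ⟨g, hg, hgd⟩ := hd
  have hk : Computable fun p : α × ℕ => (p.1, p.2 + 1) :=
    Computable.fst.pair (Computable.succ.comp .snd)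
  refine ⟨fun p => (f (p.1, p.2 + 1)).add (g (p.1, p.2 + 1)),
    RatCode.primrec_add.to_comp.comp (hf.comp hk) (hg.comp hk), fun a k => ?_⟩
  rw [RatCode.val_add, add_sub_add_comm]
  exact abs_add_le_two_inv_pow (hfc a (k + 1)) (hgd a (k + 1))

/-- The error of the product is `f (g - d) + (f - c) d`, where `|d| ≤ B` and `|f| ≤ A + 1`. -/
protected lemma mul (hc : UniformlyComputable c) (hd : UniformlyComputable d) :
    UniformlyComputable fun a => c a * d a := by
  obtain ⟨A, hA, hcA⟩ := hc.exists_natCast_bound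
  obtain ⟨B, hB, hdB⟩ := hd.exists_natCast_bound
  obtain ⟨f, hf, hfc⟩ := hc
  obtain ⟨g, hg, hgd⟩ := hd
  have hkA : Computable fun p : α × ℕ => (p.1, p.2 + 1 + (A p.1 + 1)) :=
    Computable.fst.pair (Primrec.nat_add.to_comp.comp (Computable.succ.comp .snd)
      (Computable.succ.comp (hA.comp .fst)))
  have hkB : Computable fun p : α × ℕ => (p.1, p.2 + 1 + B p.1) :=
    Computable.fst.pair (Primrec.nat_add.to_comp.comp (Computable.succ.comp .snd) (hB.comp .fst))
  refine ⟨fun p => (f (p.1, p.2 + 1 + B p.1)).mul (g (p.1, p.2 + 1 + (A p.1 + 1))),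
    RatCode.primrec_mul.to_comp.comp (hf.comp hkB) (hg.comp hkA), fun a k => ?_⟩
  set x := (f (a, k + 1 + B a)).val
  set y := (g (a, k + 1 + (A a + 1))).val
  have hx : |x - c a| ≤ 2⁻¹ ^ (k + 1 + B a) := hfc a _
  have hy : |y - d a| ≤ 2⁻¹ ^ (k + 1 + (A a + 1)) := hgd a _
  have hxA : |x| ≤ (A a + 1 : ℕ) := by
    rw [Nat.cast_add_one]
    have : (2⁻¹ : ℝ) ^ (k + 1 + B a) ≤ 1 := pow_le_one₀ (by norm_num) (by norm_num)
    linarith [abs_sub_abs_le_abs_sub x (c a), hcA a]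
  rw [RatCode.val_mul, show x * y - c a * d a = x * (y - d a) + d a * (x - c a) by ring]
  exact abs_add_le_two_inv_pow (abs_mul_le_two_inv_pow hxA hy) (abs_mul_le_two_inv_pow (hdB a) hx)

lemma ite_zero (hc : UniformlyComputable c) {p : α → Prop} [DecidablePred p] (hp : PrimrecPred p) :
    UniformlyComputable fun a => if p a then c a else 0 := by
  obtain ⟨f, hf, hfc⟩ := hc
  refine ⟨fun x => cond (decide (p x.1)) (f x) (0, 0, 0),
    .cond (hp.decide.to_comp.comp .fst) hf (.const _), fun a k => ?_⟩
  by_cases h : p a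
  · simpa [h] using hfc a k
  · simp [h, RatCode.val]

protected lemma ofDigits {b : ℕ} (hb : 1 < b) {x : α → ℕ → Fin b} (hx : Computable₂ x) :
    UniformlyComputable fun a => Real.ofDigits (x a) := by
  let term (a : α) (i : ℕ) : RatCode := (RatCode.pow (1, 0, b - 1) (i + 1)).mul (x a i, 0, 0)
  have hterm : Computable₂ term := RatCode.primrec_mul.to_comp.comp
    (RatCode.primrec_pow.to_comp.comp (.const _) (Computable.succ.comp .snd))
    ((Primrec.fin_val.to_comp.comp hx).pair (.const (0, 0)))
  have hval (a : α) (i : ℕ) : (term a i).val = Real.ofDigitsTerm (x a) i := by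
    rw [RatCode.val_mul, RatCode.val_pow, RatCode.val_natCast, Real.ofDigitsTerm, mul_comm]
    simp [RatCode.val, Nat.cast_pred (zero_lt_one.trans hb)]
  refine ⟨fun p => RatCode.sum (term p.1) p.2, RatCode.computable_sum hterm, fun a k => ?_⟩
  change |(RatCode.sum (term a) k).val - Real.ofDigits (x a)| ≤ 2⁻¹ ^ k
  rw [RatCode.val_sum, Finset.sum_congr rfl fun i _ => hval a i,
    Real.ofDigits_eq_sum_add_ofDigits (x a) k, sub_add_cancel_left, abs_neg, abs_mul,
    abs_of_nonneg (Real.ofDigits_nonneg _), abs_of_nonneg (by positivity), inv_pow]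
  refine (mul_le_of_le_one_right (by positivity) (Real.ofDigits_le_one _)).trans ?_
  gcongr
  exact_mod_cast hb

end UniformlyComputable

lemma ofDigits_pos_iff {b : ℕ} {x : ℕ → Fin b} : 0 < Real.ofDigits x ↔ ∃ i, (x i).val ≠ 0 := by
  have hb : (0 : ℝ) < b := Nat.cast_pos.2 (Fin.pos (x 0))
  constructor
  · contrapose!
    intro h
    simp [Real.ofDigits, Real.ofDigitsTerm, h]
  · rintro ⟨i, hi⟩
    refine Real.summable_ofDigitsTerm.tsum_pos (fun _ => Real.ofDigitsTerm_nonneg) i ?_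
    have : (0 : ℝ) < (x i).val := Nat.cast_pos.2 (Nat.pos_of_ne_zero hi)
    rw [Real.ofDigitsTerm]
    positivity

/-- The real number whose `k`-th binary digit says whether the computation of `M` on `x` has
halted at stage `k`. -/
noncomputable def haltingReal (M : Code) (x : ℕ) : ℝ :=
  Real.ofDigits fun k => if (M.evaln k x).isSome then (1 : Fin 2) else 0

lemma haltingReal_nonneg (M : Code) (x : ℕ) : 0 ≤ haltingReal M x := Real.ofDigits_nonneg _

lemma haltingReal_pos_iff {M : Code} {x : ℕ} : 0 < haltingReal M x ↔ (M.eval x).Dom := by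
  simp only [haltingReal, ofDigits_pos_iff, Part.dom_iff_mem, Code.evaln_complete]
  rw [exists_comm]
  simp [Option.isSome_iff_exists]

lemma uniformlyComputable_haltingReal :
    UniformlyComputable fun a : Code × ℕ => haltingReal a.1 a.2 := by
  refine .ofDigits one_lt_two (Primrec.to_comp ?_)
  exact (Primrec.dom_finite fun h : Bool => if h then (1 : Fin 2) else 0).comp <|
    Primrec.option_isSome.comp <| Code.primrec_evaln.comp <|
      (Primrec.snd.pair (Primrec.fst.comp .fst)).pair (Primrec.snd.comp .fst)

end ComputableReals

section PartialDerivatives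

variable {n : ℕ} {H G : PhasePt n → ℝ}

lemma contDiff_iterPartial (hH : ContDiff ℝ ∞ H) (l : List (Coord n)) :
    ContDiff ℝ ∞ (iterPartial H l) := by
  induction l with
  | nil => exact hH
  | cons i l ih => exact (ih.fderiv_right (m := ∞) le_rfl).clm_apply contDiff_const

lemma differentiable_iterPartial (hH : ContDiff ℝ ∞ H) (l : List (Coord n)) :
    Differentiable ℝ (iterPartial H l) :=
  (contDiff_iterPartial hH l).differentiable (by simp)

lemma iterPartial_add (hH : ContDiff ℝ ∞ H) (hG : ContDiff ℝ ∞ G) (l : List (Coord n)) :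
    iterPartial (H + G) l = iterPartial H l + iterPartial G l := by
  induction l with
  | nil => rfl
  | cons i l ih =>
    ext x
    simp only [iterPartial, ih, Pi.add_apply]
    rw [fderiv_add (differentiable_iterPartial hH l x) (differentiable_iterPartial hG l x)]
    rfl

lemma iterPartial_const_smul (hH : ContDiff ℝ ∞ H) (c : ℝ) (l : List (Coord n)) :
    iterPartial (c • H) l = c • iterPartial H l := by
  induction l with
  | nil => rfl
  | cons i l ih =>
    ext x
    simp only [iterPartial, ih, Pi.smul_apply]
    rw [fderiv_const_smul (differentiable_iterPartial hH l x)]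
    rfl

/-- The coordinate `i` as a linear functional on extended phase space. -/
def Coord.proj : Coord n → PhasePt n →L[ℝ] ℝ
  | .inl i => .proj i ∘SL .fst ℝ _ _
  | .inr (.inl i) => .proj i ∘SL .fst ℝ _ _ ∘SL .snd ℝ _ _
  | .inr (.inr _) => .snd ℝ _ _ ∘SL .snd ℝ _ _

/-- The notation of the coordinate `i` of the point denoted by `x`. -/
def RatPt.coord (x : RatPt n) : Coord n → RatCode
  | .inl i => x.1 i
  | .inr (.inl i) => x.2.1 i
  | .inr (.inr _) => x.2.2

lemma Coord.proj_val (i : Coord n) (x : RatPt n) : i.proj x.val = (x.coord i).val := by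
  rcases i with i | i | _ <;> rfl

lemma RatPt.computable_coord (i : Coord n) : Computable fun x : RatPt n => x.coord i := by
  rcases i with i | i | _
  · exact Computable.fin_app.comp .fst (.const i)
  · exact Computable.fin_app.comp (Computable.fst.comp .snd) (.const i)
  · exact Computable.snd.comp .snd

lemma Coord.proj_dir (i j : Coord n) : i.proj j.dir = if j = i then 1 else 0 := by
  rcases i with i | i | _ <;> rcases j with j | j | _ <;>
    simp [proj, dir, Pi.single_apply, eq_comm]

lemma Coord.abs_proj_le (i : Coord n) (x : PhasePt n) : |i.proj x| ≤ ‖x‖ := by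
  rcases i with i | i | _
  · exact (norm_le_pi_norm x.1 i).trans (norm_fst_le x)
  · exact (norm_le_pi_norm x.2.1 i).trans ((norm_fst_le x.2).trans (norm_snd_le x))
  · exact (norm_snd_le x.2).trans (norm_snd_le x)

lemma iterPartial_comp_proj {φ : ℝ → ℝ} (hφ : ContDiff ℝ ∞ φ) (i : Coord n) (l : List (Coord n)) :
    iterPartial (φ ∘ i.proj) l =
      fun x => if ∀ j ∈ l, j = i then iteratedDeriv l.length φ (i.proj x) else 0 := by
  induction l with
  | nil => ext; simp [iterPartial]
  | cons j l ih =>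
    ext x
    simp only [iterPartial, ih, List.forall_mem_cons, List.length_cons]
    by_cases hl : ∀ j ∈ l, j = i
    · have hderiv : HasDerivAt (iteratedDeriv l.length φ)
          (iteratedDeriv (l.length + 1) φ (i.proj x)) (i.proj x) := by
        rw [iteratedDeriv_succ]
        exact (hφ.differentiable_iteratedDeriv l.length
          (mod_cast ENat.natCast_lt_top _) _).hasDerivAt
      simp only [if_pos hl, and_iff_left hl]
      have hfderiv := (hderiv.comp_hasFDerivAt x i.proj.hasFDerivAt).fderiv
      rw [Function.comp_def] at hfderiv
      simp [hfderiv, i.proj_dir]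
    · simp only [if_neg hl, if_neg (mt And.right hl)]
      simp

end PartialDerivatives

section UniformDescriptions

variable {α : Type} [Primcodable α] {n : ℕ} {H G : α → PhasePt n → ℝ}

/-- The functions `H a` have descriptions that are computable from `a`: the programs of
`Describes`, with `a` as an additional input. -/
structure UniformlyDescribable (H : α → PhasePt n → ℝ) : Prop where
  smooth : ∀ a, ContDiff ℝ ∞ (H a)
  approx : UniformlyComputable fun p : α × List (Coord n) × RatPt n =>
    iterPartial (H p.1) p.2.1 p.2.2.val
  modulus : ∃ m : α × List (Coord n) × ℕ × ℕ → ℕ, Computable m ∧ ∀ a l (N k : ℕ), ∀ x y,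
    ‖x‖ ≤ N → ‖y‖ ≤ N → ‖x - y‖ ≤ 2⁻¹ ^ m (a, l, N, k) →
      |iterPartial (H a) l x - iterPartial (H a) l y| ≤ 2⁻¹ ^ k

namespace UniformlyDescribable

protected lemma add (hH : UniformlyDescribable H) (hG : UniformlyDescribable G) :
    UniformlyDescribable fun a => H a + G a where
  smooth a := (hH.smooth a).add (hG.smooth a)
  approx := by
    simpa only [iterPartial_add (hH.smooth _) (hG.smooth _), Pi.add_apply]
      using hH.approx.add hG.approx
  modulus := by
    obtain ⟨m, hm, hmH⟩ := hH.modulus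
    obtain ⟨m', hm', hmG⟩ := hG.modulus
    have hsucc : Computable fun p : α × List (Coord n) × ℕ × ℕ =>
        (p.1, p.2.1, p.2.2.1, p.2.2.2 + 1) :=
      Computable.fst.pair ((Computable.fst.comp .snd).pair
        ((Computable.fst.comp (Computable.snd.comp .snd)).pair
          (Computable.succ.comp (Computable.snd.comp (Computable.snd.comp .snd)))))
    refine ⟨fun p => max (m (p.1, p.2.1, p.2.2.1, p.2.2.2 + 1))
      (m' (p.1, p.2.1, p.2.2.1, p.2.2.2 + 1)),
      Primrec.nat_max.to_comp.comp (hm.comp hsucc) (hm'.comp hsucc),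
      fun a l N k x y hx hy hxy => ?_⟩
    have hle {i j : ℕ} (hij : i ≤ j) : (2⁻¹ : ℝ) ^ j ≤ 2⁻¹ ^ i :=
      pow_le_pow_of_le_one (by norm_num) (by norm_num) hij
    rw [iterPartial_add (hH.smooth a) (hG.smooth a), Pi.add_apply, Pi.add_apply, add_sub_add_comm]
    exact abs_add_le_two_inv_pow (hmH a l N (k + 1) x y hx hy (hxy.trans (hle (le_max_left _ _))))
      (hmG a l N (k + 1) x y hx hy (hxy.trans (hle (le_max_right _ _))))

protected lemma const_smul (hH : UniformlyDescribable H) {c : α → ℝ}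
    (hc : UniformlyComputable c) : UniformlyDescribable fun a => c a • H a where
  smooth a := (hH.smooth a).const_smul (c a)
  approx := by
    simpa only [iterPartial_const_smul (hH.smooth _), Pi.smul_apply, smul_eq_mul]
      using (hc.comp .fst).mul hH.approx
  modulus := by
    obtain ⟨B, hB, hcB⟩ := hc.exists_natCast_bound
    obtain ⟨m, hm, hmH⟩ := hH.modulus
    refine ⟨fun p => m (p.1, p.2.1, p.2.2.1, p.2.2.2 + B p.1), hm.comp ?_,
      fun a l N k x y hx hy hxy => ?_⟩
    · exact Computable.fst.pair ((Computable.fst.comp .snd).pair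
        ((Computable.fst.comp (Computable.snd.comp .snd)).pair (Primrec.nat_add.to_comp.comp
          (Computable.snd.comp (Computable.snd.comp .snd)) (hB.comp .fst))))
    · simp only [iterPartial_const_smul (hH.smooth a), Pi.smul_apply, smul_eq_mul, ← mul_sub]
      exact abs_mul_le_two_inv_pow (hcB a) (hmH a l N (k + B a) x y hx hy hxy)

/-- A bound for the next derivative is a Lipschitz constant for the present one. -/
lemma comp_proj {φ : ℝ → ℝ} (hφ : ContDiff ℝ ∞ φ)
    (happrox : UniformlyComputable fun p : ℕ × RatCode => iteratedDeriv p.1 φ p.2.val)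
    {B : ℕ × ℕ → ℕ} (hB : Computable B)
    (hφB : ∀ (k N : ℕ) (x : ℝ), |x| ≤ N → |iteratedDeriv k φ x| ≤ B (k, N)) (i : Coord n) :
    UniformlyDescribable fun _ : α => φ ∘ i.proj where
  smooth _ := hφ.comp i.proj.contDiff
  approx := by
    have hall : PrimrecPred fun p : α × List (Coord n) × RatPt n => ∀ j ∈ p.2.1, j = i :=
      (PrimrecPred.forall_mem_list (Primrec.eq.comp .id (.const i))).comp (Primrec.fst.comp .snd)
    have harg : Computable fun p : α × List (Coord n) × RatPt n =>
        (p.2.1.length, p.2.2.coord i) :=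
      (Computable.list_length.comp (Computable.fst.comp .snd)).pair
        ((RatPt.computable_coord i).comp (Computable.snd.comp .snd))
    simpa only [iterPartial_comp_proj hφ, i.proj_val] using (happrox.comp harg).ite_zero hall
  modulus := by
    refine ⟨fun p => p.2.2.2 + B (p.2.1.length + 1, p.2.2.1), ?_, fun _ l N k x y hx hy hxy => ?_⟩
    · have hlength : Computable fun p : α × List (Coord n) × ℕ × ℕ => p.2.1.length :=
        Computable.list_length.comp (Computable.fst.comp .snd)
      exact Primrec.nat_add.to_comp.comp (Computable.snd.comp (Computable.snd.comp .snd)) <|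
        hB.comp ((Computable.succ.comp hlength).pair
          (Computable.fst.comp (Computable.snd.comp .snd)))
    rw [iterPartial_comp_proj hφ]
    split_ifs with hl
    · have hlip := Convex.norm_image_sub_le_of_norm_deriv_le (f := iteratedDeriv l.length φ)
        (s := Set.Icc (-(N : ℝ)) N) (C := B (l.length + 1, N))
        (fun z _ => hφ.differentiable_iteratedDeriv l.length (mod_cast ENat.natCast_lt_top _) z)
        (fun z hz => by
          rw [← iteratedDeriv_succ]
          exact hφB _ _ z (abs_le.2 hz))
        (convex_Icc _ _) (abs_le.1 ((i.abs_proj_le y).trans hy))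
        (abs_le.1 ((i.abs_proj_le x).trans hx))
      refine hlip.trans ((le_abs_self _).trans (abs_mul_le_two_inv_pow (Nat.abs_cast _).le ?_))
      rw [← map_sub, Real.norm_eq_abs, abs_abs]
      exact (i.abs_proj_le _).trans hxy
    · simp

end UniformlyDescribable

lemma primrec_descFactorial (m : ℕ) : Primrec m.descFactorial := by
  refine (Primrec.nat_rec₁ 1 (f := fun k s => (m - k) * s) ?_).of_eq fun k => ?_
  · exact Primrec.nat_mul.comp (Primrec.nat_sub.comp (.const m) .fst) .snd
  · induction k with
    | zero => rfl
    | succ k ih => rw [Nat.descFactorial_succ, ← ih]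

lemma uniformlyComputable_iteratedDeriv_pow (m : ℕ) :
    UniformlyComputable fun p : ℕ × RatCode => iteratedDeriv p.1 (· ^ m) p.2.val := by
  have hpow : Computable fun p : ℕ × RatCode => p.2.pow (m - p.1) :=
    RatCode.primrec_pow.to_comp.comp .snd (Primrec.nat_sub.to_comp.comp (.const m) .fst)
  have hdesc : Computable fun p : ℕ × RatCode => m.descFactorial p.1 :=
    (primrec_descFactorial m).to_comp.comp .fst
  simpa only [iteratedDeriv_pow, RatCode.val_pow] using
    (UniformlyComputable.of_natCast hdesc).mul (.of_val hpow)

lemma uniformlyDescribable_proj_pow (i : Coord n) (m : ℕ) :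
    UniformlyDescribable fun (_ : α) x => i.proj x ^ m := by
  have hderiv := uniformlyComputable_iteratedDeriv_pow m
  obtain ⟨B, hB, hderivB⟩ := (hderiv.comp (g := fun p : ℕ × ℕ => (p.1, (p.2, 0, 0)))
    (Computable.fst.pair (Computable.snd.pair (.const (0, 0))))).exists_natCast_bound
  refine .comp_proj (φ := (· ^ m)) (contDiff_id.pow m) hderiv hB (fun k N x hx => ?_) i
  calc |iteratedDeriv k (· ^ m) x| ≤ |iteratedDeriv k (· ^ m) (N : ℝ)| := by
        simp only [iteratedDeriv_pow, abs_mul, abs_pow, Nat.abs_cast]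
        gcongr
    _ ≤ B (k, N) := by simpa only [RatCode.val_natCast] using hderivB (k, N)

/-- The `s-m-n` theorem, for total functions. -/
lemma exists_computable_code {β γ : Type} [Primcodable β] [Primcodable γ] {F : α × β → γ}
    (hF : Computable F) :
    ∃ c : α → Code, Computable c ∧ ∀ a b, enc (F (a, b)) ∈ (c a).eval (enc b) := by
  obtain ⟨c, hc⟩ := Code.exists_code.1 hF
  refine ⟨fun a => c.curry (Encodable.encode a),
    (Code.primrec₂_curry.comp (.const c) .encode).to_comp, fun a b => ?_⟩
  rw [Code.eval_curry, hc, enc, enc, ← Encodable.encode_prod_val]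
  simp

theorem UniformlyDescribable.exists_computable_describes (hH : UniformlyDescribable H) :
    ∃ f : α → Description, Computable f ∧ ∀ a, Describes (f a) (H a) := by
  obtain ⟨r, hr, hrH⟩ := hH.approx
  obtain ⟨m, hm, hmH⟩ := hH.modulus
  have hr' : Computable fun p : α × List (Coord n) × RatPt n × ℕ =>
      r ((p.1, p.2.1, p.2.2.1), p.2.2.2) :=
    hr.comp ((Computable.fst.pair ((Computable.fst.comp .snd).pair
      (Computable.fst.comp (Computable.snd.comp .snd)))).pair
        (Computable.snd.comp (Computable.snd.comp .snd)))
  obtain ⟨c, hc, hcr⟩ := exists_computable_code hr'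
  obtain ⟨e, he, hem⟩ := exists_computable_code hm
  exact ⟨fun a => (c a, e a), hc.pair he, fun a => ⟨hH.smooth a,
    fun l x k => ⟨_, hcr a (l, x, k), hrH (a, l, x) k⟩,
    fun l N k => ⟨m (a, l, N, k), hem a (l, N, k), hmH a l N k⟩⟩⟩

end UniformDescriptions

section Reduction

lemma uniformlyDescribable_particle_quartic {n : ℕ} {α : Type} [Primcodable α] {c : α → ℝ}
    (hc : UniformlyComputable c) (j : Fin n) :
    UniformlyDescribable fun a => particle (quarticPotential (c a)) j := by
  have hneg : UniformlyComputable fun a => RatCode.val (0, 1, 0) * c a :=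
    (UniformlyComputable.of_val (.const _)).mul hc
  convert (uniformlyDescribable_proj_pow (.inr (.inl j)) 2).add
    ((uniformlyDescribable_proj_pow (.inl j) 2).add
      ((uniformlyDescribable_proj_pow (.inl j) 4).const_smul hneg)) using 2 with a
  ext x
  simp [particle, quarticPotential, Coord.proj, RatCode.val, sub_eq_add_neg]

theorem not_exists_decidesSolvability {n : ℕ} {σ : SignConvention} {f : Code × ℕ → Description}
    (hf : Computable f) (h : ∀ M x, ∃ H : PhasePt n → ℝ, Describes (f (M, x)) H ∧
      ((M.eval x).Dom ↔ GloballySolvable σ H)) :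
    ¬ ∃ D : Description →. Bool, Partrec D ∧ DecidesSolvability n σ D := by
  rintro ⟨D, hD, hdecides⟩
  have hhalt (M : Code) : ∃ b ∈ D (f (M, 0)), (b = true ↔ (M.eval 0).Dom) := by
    obtain ⟨H, hH, hiff⟩ := h M 0
    rw [hiff]
    exact hdecides _ H hH
  choose b hb hb_iff using hhalt
  refine ComputablePred.halting_problem 0 (ComputablePred.computable_iff.2 ⟨b, ?_, ?_⟩)
  · exact (hD.comp (hf.comp (Computable.id.pair (.const 0)))).of_eq fun M =>
      Part.eq_some_iff.2 (hb M)
  · exact funext fun M => propext (hb_iff M).symm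

end Reduction

end HPF

theorem theorem1 (n : ℕ) (hn : 1 ≤ n) (σ : HPF.SignConvention) :
    (¬ ∃ D : HPF.Description →. Bool, Partrec D ∧ HPF.DecidesSolvability n σ D) ∧
    (∃ f : Nat.Partrec.Code × ℕ → HPF.Description, Computable f ∧
      ∀ (M : Nat.Partrec.Code) (x : ℕ), ∃ H : HPF.PhasePt n → ℝ,
        HPF.Describes (f (M, x)) H ∧
        ((M.eval x).Dom ↔ HPF.GloballySolvable σ H) ∧
        ((M.eval x).Dom →
          ∃ S : HPF.EndPts n → ℝ, ContDiff ℝ ∞ S ∧ HPF.SolvesPair H S σ)) := by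
  let j : Fin n := ⟨0, hn⟩
  obtain ⟨f, hf, hdesc⟩ := (HPF.uniformlyDescribable_particle_quartic
    HPF.uniformlyComputable_haltingReal j).exists_computable_describes
  have hiff (M : Nat.Partrec.Code) (x : ℕ) : (M.eval x).Dom ↔
      HPF.GloballySolvable σ (HPF.particle (HPF.quarticPotential (HPF.haltingReal M x)) j) :=
    HPF.haltingReal_pos_iff.symm.trans
      (HPF.globallySolvable_quartic_iff (HPF.haltingReal_nonneg M x) j σ).symm
  exact ⟨HPF.not_exists_decidesSolvability hf fun M x => ⟨_, hdesc (M, x), hiff M x⟩,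
    f, hf, fun M x => ⟨_, hdesc (M, x), hiff M x, fun h =>
      HPF.exists_contDiff_solvesPair_quartic (HPF.haltingReal_pos_iff.2 h) j σ⟩⟩
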